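/- Let $\Gamma$ be a countable discrete group and let $\mu$ be a probability vector on $\Gamma$ which is admissible (its support generates $\Gamma$ as a semigroup), finitely supported, lazy ($\mu(e)>0$) and symmetric ($\mu(x^{-1})=\mu(x)$). Put $P(x,y)=\mu(x^{-1}y)$, let $P^n(x,y)$ be the $n$-step transition probabilities, and let $R=\rho^{-1}$ with $\rho=\limsup_n P^n(e,e)^{1/n}$. Assume the strong ratio-limit property: the limit $H(x,y)=\lim_{n\to\infty}P^n(x,y)/P^n(e,y)$ exists for all $x,y\in\Gamma$. The space-time set is $\mathrm{ST}=\{(x,m)\in\Gamma\times\mathbb Z_+ : P^m(e,x)>0\}$, with the Markov kernel $P_{\mathrm{ST}}((x,m),(y,n))=\delta_{m+1,n}\,\mu(x^{-1}y)$, the Green function $G_{\mathrm{ST}}=\sum_k P_{\mathrm{ST}}^k$ and the Martin kernel $K_{\mathrm{ST}}(p,q)=G_{\mathrm{ST}}(p,q)/G_{\mathrm{ST}}((e,0),q)$. Let $\Delta_{\mathrm{ST}}\Gamma$ be the Martin compactification, i.e. the smallest compactification of $\mathrm{ST}$ in which $\mathrm{ST}$ is open, discrete and dense and to which all $K_{\mathrm{ST}}(p,\cdot)$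 extend continuously, and let $\partial_{\mathrm{ST}}\Gamma=\Delta_{\mathrm{ST}}\Gamma\setminus\mathrm{ST}$ be the space-time Martin boundary. Let $\Delta_{RL}\Gamma$ be the ratio-limit compactification, i.e. the smallest compactification of $\Gamma$ in which $\Gamma$ is open, discrete and dense and to which all $y\mapsto H(x,y)$ extend continuously. The set $R_\mu=\{y : H(x,y)=H(x,e)\text{ for all }x\in\Gamma\}$ is a subgroup, and $yR_\mu\mapsto (H(x,y))_{x\in\Gamma}$ is well defined and injective on $\Gamma/R_\mu$; let the reduced ratio-limit compactification $\Delta^r_{RL}\Gamma$ be the closure of its image in $\mathbb R^\Gamma$ (product topology), and write $H(x,\xi)$ for the $x$-th coordinate of $\xi\in\Delta^r_{RL}\Gamma$. (The first two compactifications are realized as closures in products of lines, by the values of the kernels and of the indicator functions of points.) Then $\Delta_{RL}\Gamma$, $\Delta^r_{RL}\Gamma$ and $\Delta_{\mathrm{ST}}\Gamma$ are indeed compact, and there exist a continuous map $\Phi\colon\Delta_{RL}\Gamma\to\partial_{\mathrm{ST}}\Gamma$, a continuous surjection $\Psi\colon\Delta_{RL}\Gamma\to\Delta^r_{RL}\Gamma$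 extending the quotient map $\Gamma\to\Gamma/R_\mu$, and a homeomorphism onto its image $\widetilde\Phi\colon\Delta^r_{RL}\Gamma\to\partial_{\mathrm{ST}}\Gamma$ such that $\Phi=\widetilde\Phi\circ\Psi$ and $$K_{\mathrm{ST}}\big((x,m),\widetilde\Phi(\xi)\big)=R^m H(x,\xi)\qquad\text{for all }\xi\in\Delta^r_{RL}\Gamma,\ (x,m)\in\mathrm{ST}.$$ -/

import Mathlib

open Filter Topology

noncomputable section

namespace SpaceTime

/-! ### Transition kernels, Green functions and Martin kernels on a countable set -/

/-- The `n`-step transition probabilities of the transition kernel `P` on `Ω`. -/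
def stepKernel {Ω : Type*} (P : Ω → Ω → ℝ) : ℕ → Ω → Ω → ℝ
  | 0 => fun x y => open Classical in if x = y then 1 else 0
  | n + 1 => fun x y => ∑' z, stepKernel P n x z * P z y

/-- The Green function `G(x, y) = ∑ₙ Pⁿ(x, y)`. -/
def greenKernel {Ω : Type*} (P : Ω → Ω → ℝ) (x y : Ω) : ℝ :=
  ∑' n : ℕ, stepKernel P n x y

/-- The Martin kernel `K(x, y) = G(x, y) / G(o, y)` with base point `o`. -/
def martinKernel {Ω : Type*} (P : Ω → Ω → ℝ) (o x y : Ω) : ℝ :=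
  greenKernel P x y / greenKernel P o y

/-! ### Compactification of a discrete set with respect to a family of functions -/

/-- The point of the product space `(ι → ℝ) × (Ω → ℝ)` given by the values at `y` of the functions
`K x`, `x ∈ ι`, and by the values at `y` of the indicator functions of the points of `Ω`. -/
def kernelPoint {ι Ω : Type*} (K : ι → Ω → ℝ) (y : Ω) : (ι → ℝ) × (Ω → ℝ) :=
  (fun x => K x y, fun z => open Classical in if z = y then 1 else 0)

/-- The compactification of the discrete set `Ω` with respect to the functions `K x : Ω → ℝ`
(each of them bounded): the smallest one which contains `Ω` as a discrete, open and dense subset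
and to which every `K x` extends continuously. It is realized as the closure of `Ω` in a product of
lines; the indicator functions make sure that `Ω` is embedded as an open discrete subset. -/
def compactification {ι Ω : Type*} (K : ι → Ω → ℝ) : Set ((ι → ℝ) × (Ω → ℝ)) :=
  closure (Set.range (kernelPoint K))

/-- The boundary: what the compactification adds to `Ω`. -/
def boundary {ι Ω : Type*} (K : ι → Ω → ℝ) : Set ((ι → ℝ) × (Ω → ℝ)) :=
  compactification K \ Set.range (kernelPoint K)

/-- The canonical map from `Ω` to its compactification. -/
def toCompactification {ι Ω : Type*} (K : ι → Ω → ℝ) (y : Ω) : compactification K :=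
  ⟨kernelPoint K y, subset_closure (Set.mem_range_self y)⟩

/-- The continuous extension `ξ ↦ K(x, ξ)` of `K x`, read at a boundary point. -/
def boundaryKernel {ι Ω : Type*} (K : ι → Ω → ℝ) (x : ι) (ξ : boundary K) : ℝ :=
  ξ.1.1 x

/-! ### Random walks on groups -/

variable {Γ : Type*} [Group Γ]

/-- `μ` is a probability vector on `Γ` whose support generates `Γ` as a semigroup. -/
structure IsAdmissible (μ : Γ → ℝ) : Prop where
  nonneg : ∀ x, 0 ≤ μ x
  hasSum_one : HasSum μ 1
  generates : Subsemigroup.closure {x | 0 < μ x} = ⊤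

/-- The transition kernel `P(x, y) = μ(x⁻¹y)` of the random walk. -/
def walkKernel (μ : Γ → ℝ) (x y : Γ) : ℝ := μ (x⁻¹ * y)

/-- The `n`-step transition probabilities `Pⁿ(x, y)` of the random walk. -/
def walkStep (μ : Γ → ℝ) (n : ℕ) (x y : Γ) : ℝ := stepKernel (walkKernel μ) n x y

/-- The spectral radius `ρ = limsup Pⁿ(e, e)^(1/n)`. -/
def spectralRad (μ : Γ → ℝ) : ℝ :=
  limsup (fun n : ℕ => walkStep μ n 1 1 ^ (1 / (n : ℝ))) atTop

/-- The radius of convergence `R = ρ⁻¹` of the Green function of the random walk. -/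
def convergenceRadius (μ : Γ → ℝ) : ℝ := (spectralRad μ)⁻¹

/-! ### The space-time Markov chain -/

/-- The space-time set: the pairs `(x, n)` with `Pⁿ(e, x) > 0`. -/
def SpaceTimeSet (μ : Γ → ℝ) : Type _ := {p : Γ × ℕ // 0 < walkStep μ p.2 1 p.1}

/-- The starting point `(e, 0)` of the space-time chain. -/
def spaceTimeBase (μ : Γ → ℝ) : SpaceTimeSet μ :=
  ⟨(1, 0), by simp [walkStep, stepKernel]⟩

/-- The transition kernel `P_ST((x, m), (y, n)) = δ_{m + 1, n} μ(x⁻¹y)` on the space-time set. -/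
def spaceTimeKernel (μ : Γ → ℝ) (p q : SpaceTimeSet μ) : ℝ :=
  if p.1.2 + 1 = q.1.2 then μ (p.1.1⁻¹ * q.1.1) else 0

/-- The Martin kernel of the space-time chain. -/
def spaceTimeMartinKernel (μ : Γ → ℝ) : SpaceTimeSet μ → SpaceTimeSet μ → ℝ :=
  martinKernel (spaceTimeKernel μ) (spaceTimeBase μ)

/-- The space-time Martin compactification. -/
abbrev SpaceTimeCompactification (μ : Γ → ℝ) : Type _ :=
  compactification (spaceTimeMartinKernel μ)

/-- The space-time Martin boundary. -/
abbrev SpaceTimeBoundary (μ : Γ → ℝ) : Type _ :=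
  boundary (spaceTimeMartinKernel μ)

/-! ### Ratio limits -/

/-- The strong ratio-limit property. -/
def StrongRatioLimitProperty (μ : Γ → ℝ) : Prop :=
  ∀ x y : Γ, ∃ l : ℝ, Tendsto (fun n : ℕ => walkStep μ n x y / walkStep μ n 1 y) atTop (𝓝 l)

/-- The ratio-limit kernel `H(x, y) = lim Pⁿ(x, y) / Pⁿ(e, y)`. -/
def ratioLimitKernel (μ : Γ → ℝ) (x y : Γ) : ℝ :=
  limUnder atTop (fun n : ℕ => walkStep μ n x y / walkStep μ n 1 y)

/-- The (full) ratio-limit compactification of `Γ`. -/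
abbrev RatioLimitCompactification (μ : Γ → ℝ) : Type _ :=
  compactification (ratioLimitKernel μ)

/-! #### Facts needed for the ratio-limit radical to be a subgroup -/

section Facts

variable {μ : Γ → ℝ}

theorem walkStep_succ (n : ℕ) (x y : Γ) :
    walkStep μ (n + 1) x y = ∑' z, walkStep μ n x z * μ (z⁻¹ * y) := rfl

theorem walkStep_nonneg (hμ : IsAdmissible μ) (n : ℕ) (x y : Γ) : 0 ≤ walkStep μ n x y := by
  induction n generalizing y with
  | zero =>
    simp only [walkStep, stepKernel]
    split_ifs <;> norm_num
  | succ n ih =>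
    rw [walkStep_succ]
    exact tsum_nonneg fun z => mul_nonneg (ih z) (hμ.nonneg _)

theorem walkStep_succ_pos (hμ : IsAdmissible μ) (hfin : (Function.support μ).Finite) (n : ℕ)
    (x y g : Γ) (h : 0 < walkStep μ n x y) (hg : 0 < μ g) :
    0 < walkStep μ (n + 1) x (y * g) := by
  rw [walkStep_succ]
  have hs : Summable fun z => walkStep μ n x z * μ (z⁻¹ * (y * g)) := by
    refine summable_of_hasFiniteSupport ((hfin.image fun s => y * g * s⁻¹).subset ?_)
    intro z hz
    refine ⟨z⁻¹ * (y * g), right_ne_zero_of_mul hz, by group⟩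
  refine hs.tsum_pos (fun z => mul_nonneg (walkStep_nonneg hμ n x z) (hμ.nonneg _)) y ?_
  rw [inv_mul_cancel_left]
  exact mul_pos h hg

theorem exists_walkStep_pos (hμ : IsAdmissible μ) (hfin : (Function.support μ).Finite) (y : Γ) :
    ∃ n, 0 < walkStep μ n 1 y := by
  have key : ∀ g : Γ, ∀ (n : ℕ) (y : Γ), 0 < walkStep μ n 1 y → ∃ m, 0 < walkStep μ m 1 (y * g) := by
    intro g
    have hg : g ∈ Subsemigroup.closure {x | 0 < μ x} := by rw [hμ.generates]; trivial
    induction hg using Subsemigroup.closure_induction with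
    | mem g hg => exact fun n y h => ⟨n + 1, walkStep_succ_pos hμ hfin n 1 y g h hg⟩
    | mul g k _ _ ihg ihk =>
      intro n y h
      obtain ⟨m, hm⟩ := ihg n y h
      obtain ⟨l, hl⟩ := ihk m _ hm
      exact ⟨l, by rwa [← mul_assoc]⟩
  obtain ⟨m, hm⟩ := key y 0 1 (by simp [walkStep, stepKernel])
  exact ⟨m, by rwa [one_mul] at hm⟩

theorem walkStep_mul_left (n : ℕ) (g x y : Γ) :
    walkStep μ n (g * x) (g * y) = walkStep μ n x y := by
  induction n generalizing y with
  | zero =>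
    simp only [walkStep, stepKernel]
    by_cases h : x = y
    · simp [h]
    · rw [if_neg h, if_neg fun h' => h (mul_left_cancel h')]
  | succ n ih =>
    rw [walkStep_succ, walkStep_succ, ← (Equiv.mulLeft g).tsum_eq]
    refine tsum_congr fun z => ?_
    simp only [Equiv.coe_mulLeft, ih]
    congr 2
    group

theorem eventually_walkStep_pos (hμ : IsAdmissible μ) (hfin : (Function.support μ).Finite)
    (hlazy : 0 < μ 1) (x y : Γ) : ∀ᶠ n in atTop, 0 < walkStep μ n x y := by
  obtain ⟨m, hm⟩ := exists_walkStep_pos hμ hfin (x⁻¹ * y)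
  have hm' : 0 < walkStep μ m x y := by
    rw [← walkStep_mul_left m x⁻¹ x y, inv_mul_cancel]; exact hm
  refine eventually_atTop.2 ⟨m, fun n hn => ?_⟩
  induction n, hn using Nat.le_induction with
  | base => exact hm'
  | succ n _ ih => simpa using walkStep_succ_pos hμ hfin n x y 1 ih hlazy

theorem tendsto_ratioLimitKernel (hS : StrongRatioLimitProperty μ) (x y : Γ) :
    Tendsto (fun n : ℕ => walkStep μ n x y / walkStep μ n 1 y) atTop
      (𝓝 (ratioLimitKernel μ x y)) :=
  tendsto_nhds_limUnder (hS x y)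

theorem ratioLimitKernel_mul_inv (hμ : IsAdmissible μ) (hfin : (Function.support μ).Finite)
    (hlazy : 0 < μ 1) (hS : StrongRatioLimitProperty μ) (z w : Γ) :
    ratioLimitKernel μ z w * ratioLimitKernel μ z⁻¹ (z⁻¹ * w) = 1 := by
  refine tendsto_nhds_unique
    ((tendsto_ratioLimitKernel hS z w).mul (tendsto_ratioLimitKernel hS z⁻¹ (z⁻¹ * w))) ?_
  refine tendsto_const_nhds.congr' ?_
  filter_upwards [eventually_walkStep_pos hμ hfin hlazy z w,
    eventually_walkStep_pos hμ hfin hlazy 1 w] with n h1 h2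
  have e1 : walkStep μ n z⁻¹ (z⁻¹ * w) = walkStep μ n 1 w := by
    rw [← walkStep_mul_left n z]; simp
  have e2 : walkStep μ n 1 (z⁻¹ * w) = walkStep μ n z w := by
    rw [← walkStep_mul_left n z]; simp
  rw [e1, e2]
  field_simp

theorem ratioLimitKernel_cocycle (hμ : IsAdmissible μ) (hfin : (Function.support μ).Finite)
    (hlazy : 0 < μ 1) (hS : StrongRatioLimitProperty μ) (z x y : Γ) :
    ratioLimitKernel μ x y = ratioLimitKernel μ (z * x) (z * y) / ratioLimitKernel μ z (z * y) := by
  have hne : ratioLimitKernel μ z (z * y) ≠ 0 :=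
    left_ne_zero_of_mul_eq_one (ratioLimitKernel_mul_inv hμ hfin hlazy hS z (z * y))
  refine tendsto_nhds_unique (tendsto_ratioLimitKernel hS x y)
    (((tendsto_ratioLimitKernel hS (z * x) (z * y)).div
      (tendsto_ratioLimitKernel hS z (z * y)) hne).congr' ?_)
  filter_upwards [eventually_walkStep_pos hμ hfin hlazy z (z * y),
    eventually_walkStep_pos hμ hfin hlazy 1 (z * y)] with n h1 h2
  have e : walkStep μ n z (z * y) = walkStep μ n 1 y := by
    rw [← walkStep_mul_left n z 1 y, mul_one]
  simp only [Pi.div_apply]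
  rw [← walkStep_mul_left n z x y, ← e]
  field_simp

end Facts

/-- The ratio-limit radical `R_μ = {y | H(x, y) = H(x, e) for all x}`, a subgroup of `Γ`. -/
def ratioLimitRadical {μ : Γ → ℝ} (hμ : IsAdmissible μ) (hfin : (Function.support μ).Finite)
    (hlazy : 0 < μ 1) (hS : StrongRatioLimitProperty μ) : Subgroup Γ where
  carrier := {y | ∀ x, ratioLimitKernel μ x y = ratioLimitKernel μ x 1}
  one_mem' := fun _ => rfl
  mul_mem' := by
    intro a b ha hb x
    rw [ratioLimitKernel_cocycle hμ hfin hlazy hS a⁻¹ x (a * b), inv_mul_cancel_left, hb, hb,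
      ← ha x, ratioLimitKernel_cocycle hμ hfin hlazy hS a⁻¹ x a, inv_mul_cancel]
  inv_mem' := by
    intro a ha x
    rw [ratioLimitKernel_cocycle hμ hfin hlazy hS a x a⁻¹, mul_inv_cancel, ← ha, ← ha,
      ratioLimitKernel_cocycle hμ hfin hlazy hS a x 1, mul_one]

/-- The ratio-limit kernels `y R_μ ↦ H(·, y)` as a (well-defined) function on `Γ / R_μ`. -/
def reducedKernelPoint {μ : Γ → ℝ} (hμ : IsAdmissible μ) (hfin : (Function.support μ).Finite)
    (hlazy : 0 < μ 1) (hS : StrongRatioLimitProperty μ) :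
    Γ ⧸ ratioLimitRadical hμ hfin hlazy hS → Γ → ℝ :=
  Quotient.lift (fun y x => ratioLimitKernel μ x y) (by
    intro a b hab
    have h : a⁻¹ * b ∈ ratioLimitRadical hμ hfin hlazy hS :=
      QuotientGroup.leftRel_apply.1 hab
    funext x
    rw [ratioLimitKernel_cocycle hμ hfin hlazy hS a⁻¹ x a,
      ratioLimitKernel_cocycle hμ hfin hlazy hS a⁻¹ x b, h, h, inv_mul_cancel])

/-- On `Γ / R_μ` the ratio-limit kernels separate points. -/
theorem reducedKernelPoint_injective {μ : Γ → ℝ} (hμ : IsAdmissible μ)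
    (hfin : (Function.support μ).Finite) (hlazy : 0 < μ 1) (hS : StrongRatioLimitProperty μ) :
    Function.Injective (reducedKernelPoint hμ hfin hlazy hS) := by
  rintro ⟨a⟩ ⟨b⟩ hab
  refine QuotientGroup.eq.2 fun x => ?_
  have h : ∀ x, ratioLimitKernel μ x a = ratioLimitKernel μ x b := fun x => congrFun hab x
  rw [ratioLimitKernel_cocycle hμ hfin hlazy hS a x (a⁻¹ * b), mul_inv_cancel_left, ← h, ← h,
    ratioLimitKernel_cocycle hμ hfin hlazy hS a x 1, mul_one]

/-- The reduced ratio-limit compactification: the smallest compactification of `Γ / R_μ` to which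
all the functions `y R_μ ↦ H(x, y)` extend continuously. As these functions separate the points of
`Γ / R_μ`, it is the closure of `Γ / R_μ` in the product of lines, with no indicator functions, so
that the extended kernels `ξ ↦ H(x, ξ)` separate all points. -/
abbrev ReducedCompactification {μ : Γ → ℝ} (hμ : IsAdmissible μ)
    (hfin : (Function.support μ).Finite) (hlazy : 0 < μ 1) (hS : StrongRatioLimitProperty μ) :
    Type _ :=
  closure (Set.range (reducedKernelPoint hμ hfin hlazy hS))

/-- The canonical map from `Γ / R_μ` to the reduced ratio-limit compactification. -/
def toReducedCompactification {μ : Γ → ℝ} (hμ : IsAdmissible μ)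
    (hfin : (Function.support μ).Finite) (hlazy : 0 < μ 1) (hS : StrongRatioLimitProperty μ)
    (c : Γ ⧸ ratioLimitRadical hμ hfin hlazy hS) : ReducedCompactification hμ hfin hlazy hS :=
  ⟨reducedKernelPoint hμ hfin hlazy hS c, subset_closure (Set.mem_range_self c)⟩

/-- The extended ratio-limit kernel `H(x, ξ)` at a point `ξ` of the reduced compactification. -/
def reducedKernel {μ : Γ → ℝ} (hμ : IsAdmissible μ) (hfin : (Function.support μ).Finite)
    (hlazy : 0 < μ 1) (hS : StrongRatioLimitProperty μ) (x : Γ)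
    (ξ : ReducedCompactification hμ hfin hlazy hS) : ℝ :=
  ξ.1 x

end SpaceTime

end

noncomputable section

namespace SpaceTime

variable {Γ : Type*} [Group Γ] {μ : Γ → ℝ}

/-! ### Step probabilities of the random walk -/

/-! Fix `y` and move along the space-time points `(y, n)`. The Martin kernel there is `Pⁿ⁻ᵐ(x, y) /
Pⁿ(e, y)`, the product of `Pⁿ⁻ᵐ(x, y) / Pⁿ⁻ᵐ(e, y)`, which tends to `H(x, y)`, and `Pⁿ⁻ᵐ(e, y) /
Pⁿ(e, y)`. The ratio-limit property forces `Pⁿ⁺¹(e, y) / Pⁿ(e, y) → ρ`, so the second factor tends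
to `Rᵐ` (`tendsto_walkStep_sub_div`). Hence `(y, n)` converges to a boundary point with kernel `Rᵐ
H(x, y)`.

The map `h ↦ (Rᵐ h(x), 0)` is continuous and injective on all of `Γ → ℝ`, so it carries the closure
of the kernels `H(·, y)` into the boundary. Compactness makes this an embedding and makes the
projection `Ψ`, which drops the indicator coordinates, surjective. Compactness itself comes from
pointwise bounds on the kernels, all consequences of `walkStep_mul_walkStep_le`. -/

theorem walkStep_succ_eq_sum (hfin : (Function.support μ).Finite) (n : ℕ) (x y : Γ) :
    walkStep μ (n + 1) x y = ∑ t ∈ hfin.toFinset, walkStep μ n x (y * t⁻¹) * μ t := by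
  rw [walkStep_succ, ← ((Equiv.inv Γ).trans (Equiv.mulLeft y)).tsum_eq]
  simp only [Equiv.trans_apply, Equiv.inv_apply, Equiv.coe_mulLeft, mul_inv_rev, inv_inv,
    inv_mul_cancel_right]
  refine tsum_eq_sum fun t ht => ?_
  have : μ t = 0 := by simpa using ht
  rw [this, mul_zero]

/-- The recursion splits off the last step; splitting off the first one moves the starting point,
the variable in which the ratio limits are taken. -/
theorem walkStep_succ_eq_sum_first (hfin : (Function.support μ).Finite) (n : ℕ) (x y : Γ) :
    walkStep μ (n + 1) x y = ∑ s ∈ hfin.toFinset, μ s * walkStep μ n (x * s) y := by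
  induction n generalizing y with
  | zero =>
    rw [walkStep_succ_eq_sum hfin]
    refine Finset.sum_congr rfl fun s _ => ?_
    have h : x = y * s⁻¹ ↔ x * s = y := eq_mul_inv_iff_mul_eq
    rw [mul_comm]
    by_cases hs : x * s = y
    · simp [walkStep, stepKernel, h.2 hs]
    · simp [walkStep, stepKernel, hs, mt h.1 hs]
  | succ n ih =>
    rw [walkStep_succ_eq_sum hfin]
    simp_rw [ih, walkStep_succ_eq_sum hfin n, Finset.sum_mul, Finset.mul_sum]
    rw [Finset.sum_comm]
    simp_rw [mul_assoc]

theorem summable_walkStep_mul (hfin : (Function.support μ).Finite) (n : ℕ) (x y : Γ) :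
    Summable fun z => walkStep μ n x z * μ (z⁻¹ * y) := by
  refine summable_of_hasFiniteSupport ((hfin.image fun s => y * s⁻¹).subset ?_)
  intro z hz
  exact ⟨z⁻¹ * y, right_ne_zero_of_mul hz, by group⟩

/-- Chapman–Kolmogorov with a single intermediate point kept. -/
theorem walkStep_mul_walkStep_le (hμ : IsAdmissible μ) (hfin : (Function.support μ).Finite)
    (m n : ℕ) (x z y : Γ) :
    walkStep μ m x z * walkStep μ n z y ≤ walkStep μ (m + n) x y := by
  induction n generalizing y with
  | zero =>
    by_cases h : z = y
    · simp [walkStep, stepKernel, h]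
    · simpa [h, walkStep, stepKernel] using walkStep_nonneg hμ m x y
  | succ n ih =>
    rw [← add_assoc, walkStep_succ, walkStep_succ, ← tsum_mul_left]
    refine Summable.tsum_le_tsum (fun w => ?_) ((summable_walkStep_mul hfin n z y).mul_left _)
      (summable_walkStep_mul hfin (m + n) x y)
    rw [← mul_assoc]
    exact mul_le_mul_of_nonneg_right (ih w) (hμ.nonneg _)

theorem walkStep_self_pos (hμ : IsAdmissible μ) (hfin : (Function.support μ).Finite)
    (hlazy : 0 < μ 1) (n : ℕ) : 0 < walkStep μ n 1 1 := by
  induction n with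
  | zero => simp [walkStep, stepKernel]
  | succ n ih => simpa using walkStep_succ_pos hμ hfin n 1 1 1 ih hlazy

/-! ### Roots and ratios -/

/-- The Cesàro means of `log (a (n + 1) / a n)` telescope to `(log (a n) - log (a 0)) / n`. -/
theorem tendsto_rpow_one_div_of_tendsto_ratio {a : ℕ → ℝ} {l : ℝ} (ha : ∀ n, 0 < a n)
    (hl : 0 < l) (h : Tendsto (fun n => a (n + 1) / a n) atTop (𝓝 l)) :
    Tendsto (fun n : ℕ => a n ^ (1 / (n : ℝ))) atTop (𝓝 l) := by
  have h1 := ((Real.continuousAt_log hl.ne').tendsto.comp h).cesaro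
  have h2 : Tendsto (fun n : ℕ => (n : ℝ)⁻¹ * Real.log (a 0)) atTop (𝓝 0) := by
    simpa using (tendsto_inv_atTop_nhds_zero_nat (𝕜 := ℝ)).mul_const (Real.log (a 0))
  have h3 := (Real.continuous_exp.tendsto _).comp (h1.add h2)
  rw [add_zero, Real.exp_log hl] at h3
  refine h3.congr fun n => ?_
  have e : ∑ i ∈ Finset.range n, Real.log (a (i + 1) / a i) = Real.log (a n) - Real.log (a 0) := by
    rw [← Finset.sum_range_sub fun i => Real.log (a i)]
    exact Finset.sum_congr rfl fun i _ => Real.log_div (ha _).ne' (ha _).ne'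
  simp only [Function.comp_apply, e]
  rw [Real.rpow_def_of_pos (ha n)]
  congr 1
  ring

/-! ### Consequences of the strong ratio-limit property -/

theorem ratioLimitKernel_pos (hμ : IsAdmissible μ) (hfin : (Function.support μ).Finite)
    (hlazy : 0 < μ 1) (hS : StrongRatioLimitProperty μ) (x y : Γ) :
    0 < ratioLimitKernel μ x y := by
  refine lt_of_le_of_ne (ge_of_tendsto' (tendsto_ratioLimitKernel hS x y) fun n =>
    div_nonneg (walkStep_nonneg hμ n x y) (walkStep_nonneg hμ n 1 y)) ?_
  exact (left_ne_zero_of_mul_eq_one (ratioLimitKernel_mul_inv hμ hfin hlazy hS x y)).symm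

/-- Dividing the first-step decomposition by `Pⁿ(e, e)` shows that the ratios converge to `∑ μ(s)
H(s, e)`; comparison with the `n`-th roots identifies this sum as `ρ`. -/
theorem tendsto_walkStep_succ_div_self (hμ : IsAdmissible μ)
    (hfin : (Function.support μ).Finite) (hlazy : 0 < μ 1) (hS : StrongRatioLimitProperty μ) :
    0 < spectralRad μ ∧
      Tendsto (fun n => walkStep μ (n + 1) 1 1 / walkStep μ n 1 1) atTop (𝓝 (spectralRad μ)) := by
  have hlim : Tendsto (fun n => walkStep μ (n + 1) 1 1 / walkStep μ n 1 1) atTop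
      (𝓝 (∑ s ∈ hfin.toFinset, μ s * ratioLimitKernel μ s 1)) := by
    refine (tendsto_finsetSum hfin.toFinset fun s _ =>
      (tendsto_ratioLimitKernel hS s 1).const_mul (μ s)).congr fun n => ?_
    rw [walkStep_succ_eq_sum_first hfin, Finset.sum_div]
    simp only [one_mul, mul_div_assoc]
  have hpos : 0 < ∑ s ∈ hfin.toFinset, μ s * ratioLimitKernel μ s 1 := by
    refine Finset.sum_pos' (fun s _ => mul_nonneg (hμ.nonneg s)
      (ratioLimitKernel_pos hμ hfin hlazy hS s 1).le)
      ⟨1, by simpa using hlazy.ne', mul_pos hlazy (ratioLimitKernel_pos hμ hfin hlazy hS 1 1)⟩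
  have heq : spectralRad μ = ∑ s ∈ hfin.toFinset, μ s * ratioLimitKernel μ s 1 :=
    (tendsto_rpow_one_div_of_tendsto_ratio (walkStep_self_pos hμ hfin hlazy) hpos hlim).limsup_eq
  rw [heq]
  exact ⟨hpos, hlim⟩

theorem tendsto_walkStep_succ_div (hμ : IsAdmissible μ)
    (hfin : (Function.support μ).Finite) (hlazy : 0 < μ 1) (hS : StrongRatioLimitProperty μ)
    (y : Γ) :
    Tendsto (fun n => walkStep μ (n + 1) 1 y / walkStep μ n 1 y) atTop (𝓝 (spectralRad μ)) := by
  have hy : ∀ n, walkStep μ n 1 y = walkStep μ n y⁻¹ 1 := fun n => by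
    rw [← walkStep_mul_left n y⁻¹ 1 y]; simp
  have h0 := tendsto_ratioLimitKernel hS y⁻¹ 1
  have hne := (ratioLimitKernel_pos hμ hfin hlazy hS y⁻¹ 1).ne'
  -- With `Pⁿ(e, y) = Pⁿ(y⁻¹, e)`, the ratio at `y` is the one at `e` times a quotient of
  -- consecutive approximations to `H(y⁻¹, e) ≠ 0`, which tends to 1.
  have h := ((h0.comp (tendsto_add_atTop_nat 1)).mul
    (tendsto_walkStep_succ_div_self hμ hfin hlazy hS).2).div h0 hne
  rw [mul_div_cancel_left₀ _ hne] at h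
  refine h.congr' ?_
  filter_upwards [eventually_walkStep_pos hμ hfin hlazy y⁻¹ 1] with n hn
  have h1 := (walkStep_self_pos hμ hfin hlazy n).ne'
  have h2 := (walkStep_self_pos hμ hfin hlazy (n + 1)).ne'
  simp only [Function.comp_apply, hy, Pi.div_apply]
  field_simp

theorem tendsto_walkStep_add_div (hμ : IsAdmissible μ)
    (hfin : (Function.support μ).Finite) (hlazy : 0 < μ 1) (hS : StrongRatioLimitProperty μ)
    (y : Γ) (k : ℕ) :
    Tendsto (fun n => walkStep μ (n + k) 1 y / walkStep μ n 1 y) atTop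
      (𝓝 (spectralRad μ ^ k)) := by
  induction k with
  | zero =>
    refine tendsto_const_nhds.congr' ?_
    filter_upwards [eventually_walkStep_pos hμ hfin hlazy 1 y] with n hn
    simp [hn.ne']
  | succ k ih =>
    rw [pow_succ']
    refine ((((tendsto_walkStep_succ_div hμ hfin hlazy hS y).comp
      (tendsto_add_atTop_nat k))).mul ih).congr' ?_
    filter_upwards [(tendsto_add_atTop_nat k).eventually
      (eventually_walkStep_pos hμ hfin hlazy 1 y)] with n hn
    exact div_mul_div_cancel₀ hn.ne'

/-- Limit of `Pᵏ(e, x) Pⁿ(x, y) ≤ Pⁿ⁺ᵏ(e, y)`. The bound does not depend on `y`, as compactness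
requires. -/
theorem ratioLimitKernel_le (hμ : IsAdmissible μ) (hfin : (Function.support μ).Finite)
    (hlazy : 0 < μ 1) (hS : StrongRatioLimitProperty μ) {k : ℕ} {x : Γ}
    (hk : 0 < walkStep μ k 1 x) (y : Γ) :
    ratioLimitKernel μ x y ≤ spectralRad μ ^ k / walkStep μ k 1 x := by
  refine le_of_tendsto_of_tendsto' (tendsto_ratioLimitKernel hS x y)
    ((tendsto_walkStep_add_div hμ hfin hlazy hS y k).div_const _) fun n => ?_
  rw [div_right_comm]
  refine div_le_div_of_nonneg_right ?_ (walkStep_nonneg hμ n 1 y)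
  rw [le_div_iff₀ hk, mul_comm, add_comm]
  exact walkStep_mul_walkStep_le hμ hfin k n 1 x y

/-! ### The space-time chain -/

theorem stepKernel_spaceTimeKernel (hμ : IsAdmissible μ) (hfin : (Function.support μ).Finite)
    (k : ℕ) (p q : SpaceTimeSet μ) :
    stepKernel (spaceTimeKernel μ) k p q =
      if p.1.2 + k = q.1.2 then walkStep μ k p.1.1 q.1.1 else 0 := by
  induction k generalizing q with
  | zero =>
    by_cases h : p = q
    · simp [h, walkStep, stepKernel]
    · have h' : p.1.2 = q.1.2 → p.1.1 ≠ q.1.1 := fun h2 h1 => h (Subtype.ext (Prod.ext h1 h2))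
      simp +contextual [h, h', walkStep, stepKernel]
  | succ k ih =>
    simp only [stepKernel, ih, spaceTimeKernel]
    split_ifs with hq
    · rw [walkStep_succ]
      -- Restricting to the space-time set loses no paths: whatever is reached from a space-time
      -- point is reached from `(e, 0)`.
      have hmem : ∀ w : Function.support fun z => walkStep μ k p.1.1 z * μ (z⁻¹ * q.1.1),
          0 < walkStep μ (p.1.2 + k) 1 w := fun w =>
        (mul_pos p.2 ((walkStep_nonneg hμ k p.1.1 w).lt_of_ne'
          (left_ne_zero_of_mul w.2))).trans_le (walkStep_mul_walkStep_le hμ hfin _ _ _ _ _)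
      refine tsum_eq_tsum_of_ne_zero_bij
        (fun w => (⟨(w.1, p.1.2 + k), hmem w⟩ : SpaceTimeSet μ)) ?_ ?_ ?_
      · intro v w h
        exact Subtype.ext (congrArg (fun r : SpaceTimeSet μ => r.1.1) h)
      · intro z hz
        have hz1 : p.1.2 + k = z.1.2 := by
          by_contra h
          simp [h] at hz
        have hz2 : z.1.2 + 1 = q.1.2 := by omega
        simp only [Function.mem_support, if_pos hz1, if_pos hz2] at hz
        exact ⟨⟨z.1.1, hz⟩, Subtype.ext (Prod.ext rfl hz1)⟩
      · intro w
        simp [← hq, add_assoc]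
    · refine (tsum_congr fun z => ?_).trans tsum_zero
      split_ifs <;> first | omega | simp

theorem greenKernel_spaceTimeKernel (hμ : IsAdmissible μ) (hfin : (Function.support μ).Finite)
    (p q : SpaceTimeSet μ) :
    greenKernel (spaceTimeKernel μ) p q =
      if p.1.2 ≤ q.1.2 then walkStep μ (q.1.2 - p.1.2) p.1.1 q.1.1 else 0 := by
  simp only [greenKernel, stepKernel_spaceTimeKernel hμ hfin]
  rw [tsum_eq_single (q.1.2 - p.1.2) fun k hk => if_neg (by omega)]
  exact if_congr (by omega) rfl rfl

theorem spaceTimeMartinKernel_eq (hμ : IsAdmissible μ) (hfin : (Function.support μ).Finite)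
    (p q : SpaceTimeSet μ) :
    spaceTimeMartinKernel μ p q =
      (if p.1.2 ≤ q.1.2 then walkStep μ (q.1.2 - p.1.2) p.1.1 q.1.1 else 0) /
        walkStep μ q.1.2 1 q.1.1 := by
  rw [spaceTimeMartinKernel, martinKernel, greenKernel_spaceTimeKernel hμ hfin,
    greenKernel_spaceTimeKernel hμ hfin]
  simp [spaceTimeBase]

theorem spaceTimeMartinKernel_mem_Icc (hμ : IsAdmissible μ)
    (hfin : (Function.support μ).Finite) (p q : SpaceTimeSet μ) :
    spaceTimeMartinKernel μ p q ∈ Set.Icc 0 (1 / walkStep μ p.1.2 1 p.1.1) := by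
  rw [spaceTimeMartinKernel_eq hμ hfin]
  have hp := p.2
  have hq := q.2
  split_ifs with h
  · refine ⟨div_nonneg (walkStep_nonneg hμ _ _ _) hq.le, ?_⟩
    rw [div_le_div_iff₀ hq hp, one_mul, mul_comm]
    simpa [Nat.add_sub_cancel' h] using
      walkStep_mul_walkStep_le hμ hfin p.1.2 (q.1.2 - p.1.2) 1 p.1.1 q.1.1
  · rw [zero_div]
    exact ⟨le_rfl, (one_div_pos.2 hp).le⟩

theorem tendsto_walkStep_sub_div (hμ : IsAdmissible μ) (hfin : (Function.support μ).Finite)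
    (hlazy : 0 < μ 1) (hS : StrongRatioLimitProperty μ) (x y : Γ) (m : ℕ) :
    Tendsto (fun n => walkStep μ (n - m) x y / walkStep μ n 1 y) atTop
      (𝓝 (convergenceRadius μ ^ m * ratioLimitKernel μ x y)) := by
  -- Replacing `n` by `n + m` removes the truncated subtraction.
  rw [← tendsto_add_atTop_iff_nat m, convergenceRadius, inv_pow, mul_comm, ← div_eq_mul_inv]
  refine ((tendsto_ratioLimitKernel hS x y).div (tendsto_walkStep_add_div hμ hfin hlazy hS y m)
    (pow_pos (tendsto_walkStep_succ_div_self hμ hfin hlazy hS).1 m).ne').congr' ?_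
  filter_upwards [eventually_walkStep_pos hμ hfin hlazy 1 y] with n hn
  simp only [Pi.div_apply, Nat.add_sub_cancel]
  exact div_div_div_cancel_right₀ hn.ne' _ _

/-! ### Compactness -/

theorem isCompact_compactification {ι Ω : Type*} {K : ι → Ω → ℝ} {a b : ι → ℝ}
    (hK : ∀ x y, K x y ∈ Set.Icc (a x) (b x)) : IsCompact (compactification K) := by
  refine ((isCompact_univ_pi fun x => isCompact_Icc (a := a x) (b := b x)).prod
    (isCompact_univ_pi fun _ : Ω => isCompact_Icc (a := (0 : ℝ)) (b := 1))).closure_of_subset ?_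
  rintro _ ⟨y, rfl⟩
  refine ⟨fun x _ => hK x y, fun z _ => ?_⟩
  simp only [kernelPoint]
  split_ifs <;> simp

theorem isCompact_ratioLimitCompactification (hμ : IsAdmissible μ)
    (hfin : (Function.support μ).Finite) (hlazy : 0 < μ 1) (hS : StrongRatioLimitProperty μ) :
    IsCompact (compactification (ratioLimitKernel μ)) := by
  choose k hk using exists_walkStep_pos hμ hfin
  exact isCompact_compactification fun x y => ⟨(ratioLimitKernel_pos hμ hfin hlazy hS x y).le,
    ratioLimitKernel_le hμ hfin hlazy hS (hk x) y⟩

theorem isCompact_spaceTimeCompactification (hμ : IsAdmissible μ)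
    (hfin : (Function.support μ).Finite) :
    IsCompact (compactification (spaceTimeMartinKernel μ)) :=
  isCompact_compactification (spaceTimeMartinKernel_mem_Icc hμ hfin)

/-! ### Points of the space-time product with vanishing indicator functions -/

/-- The point of the product of lines with kernel values `(x, m) ↦ Rᵐ h(x)` and vanishing indicator
functions. -/
def spaceTimePoint (μ h : Γ → ℝ) : (SpaceTimeSet μ → ℝ) × (SpaceTimeSet μ → ℝ) :=
  (fun p => convergenceRadius μ ^ p.1.2 * h p.1.1, 0)

theorem continuous_spaceTimePoint : Continuous (spaceTimePoint μ) :=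
  (continuous_pi fun _ => continuous_const.mul (continuous_apply _)).prodMk continuous_const

theorem spaceTimePoint_notMem_range (h : Γ → ℝ) :
    spaceTimePoint μ h ∉ Set.range (kernelPoint (spaceTimeMartinKernel μ)) := by
  rintro ⟨q, hq⟩
  -- A point of the space-time set has indicator coordinate 1 at itself.
  have := congrFun (congrArg Prod.snd hq) q
  simp [kernelPoint, spaceTimePoint] at this

theorem spaceTimePoint_ratioLimitKernel_mem (hμ : IsAdmissible μ)
    (hfin : (Function.support μ).Finite) (hlazy : 0 < μ 1) (hS : StrongRatioLimitProperty μ) (y : Γ) :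
    spaceTimePoint μ (fun x => ratioLimitKernel μ x y) ∈
      compactification (spaceTimeMartinKernel μ) := by
  obtain ⟨N, hN⟩ := eventually_atTop.1 (eventually_walkStep_pos hμ hfin hlazy 1 y)
  -- The shift by `N` keeps the whole sequence in the space-time set.
  let q : ℕ → SpaceTimeSet μ := fun n => ⟨(y, n + N), hN _ (Nat.le_add_left N n)⟩
  refine mem_closure_of_tendsto (f := fun n => kernelPoint (spaceTimeMartinKernel μ) (q n))
    (b := atTop) ?_ (Eventually.of_forall fun n => Set.mem_range_self _)
  refine Tendsto.prodMk_nhds (tendsto_pi_nhds.2 fun p => ?_) (tendsto_pi_nhds.2 fun z => ?_)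
  · refine ((tendsto_walkStep_sub_div hμ hfin hlazy hS p.1.1 y p.1.2).comp
      (tendsto_add_atTop_nat N)).congr' ?_
    filter_upwards [eventually_ge_atTop p.1.2] with n hn
    rw [spaceTimeMartinKernel_eq hμ hfin, if_pos (hn.trans (Nat.le_add_right n N))]
    rfl
  · refine tendsto_const_nhds.congr' ?_
    filter_upwards [eventually_gt_atTop z.1.2] with n hn
    refine (if_neg fun h => ?_).symm
    have : z.1.2 = n + N := congrArg (fun r : SpaceTimeSet μ => r.1.2) h
    omega

/-- Every `x` occurs in some space-time point `(x, m)`, and `Rᵐ ≠ 0`. -/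
theorem spaceTimePoint_injective (hμ : IsAdmissible μ)
    (hfin : (Function.support μ).Finite) (hlazy : 0 < μ 1) (hS : StrongRatioLimitProperty μ) :
    Function.Injective (spaceTimePoint μ) := by
  intro g h hgh
  funext x
  obtain ⟨m, hm⟩ := exists_walkStep_pos hμ hfin x
  have hR : convergenceRadius μ ^ m ≠ 0 :=
    pow_ne_zero _ (inv_ne_zero (tendsto_walkStep_succ_div_self hμ hfin hlazy hS).1.ne')
  exact mul_left_cancel₀ hR (congrFun (congrArg Prod.fst hgh) ⟨(x, m), hm⟩)

/-! ### The map from the full to the reduced ratio-limit compactification -/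

section Maps

variable (hμ : IsAdmissible μ) (hfin : (Function.support μ).Finite) (hlazy : 0 < μ 1)
  (hS : StrongRatioLimitProperty μ)

theorem range_reducedKernelPoint :
    Set.range (reducedKernelPoint hμ hfin hlazy hS) =
      Prod.fst '' Set.range (kernelPoint (ratioLimitKernel μ)) := by
  rw [← Set.range_comp, ← (QuotientGroup.mk_surjective
    (s := ratioLimitRadical hμ hfin hlazy hS)).range_comp]
  rfl

theorem fst_image_ratioLimitCompactification :
    Prod.fst '' compactification (ratioLimitKernel μ) =
      closure (Set.range (reducedKernelPoint hμ hfin hlazy hS)) := by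
  rw [range_reducedKernelPoint]
  -- The image of a compact set is closed, so it contains the closure of the projected kernel
  -- points.
  refine (image_closure_subset_closure_image continuous_fst).antisymm
    (closure_minimal (Set.image_mono subset_closure) ?_)
  exact ((isCompact_ratioLimitCompactification hμ hfin hlazy hS).image continuous_fst).isClosed

/-- The map from the ratio-limit compactification to the reduced one which forgets the values of
the indicator functions. -/
def reduction (ξ : RatioLimitCompactification μ) : ReducedCompactification hμ hfin hlazy hS :=
  ⟨ξ.1.1, (fst_image_ratioLimitCompactification hμ hfin hlazy hS).subset ⟨ξ.1, ξ.2, rfl⟩⟩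

theorem continuous_reduction : Continuous (reduction hμ hfin hlazy hS) :=
  (continuous_fst.comp continuous_subtype_val).subtype_mk _

theorem reduction_surjective : Function.Surjective (reduction hμ hfin hlazy hS) := by
  intro ξ
  obtain ⟨η, hη, h⟩ := (fst_image_ratioLimitCompactification hμ hfin hlazy hS).superset ξ.2
  exact ⟨⟨η, hη⟩, Subtype.ext h⟩

/-! ### The map from the reduced ratio-limit compactification to the space-time boundary -/

theorem spaceTimePoint_mem_boundary (ξ : ReducedCompactification hμ hfin hlazy hS) :
    spaceTimePoint μ ξ.1 ∈ boundary (spaceTimeMartinKernel μ) := by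
  refine ⟨?_, spaceTimePoint_notMem_range _⟩
  refine closure_minimal ?_ (isClosed_closure.preimage continuous_spaceTimePoint) ξ.2
  rintro _ ⟨⟨y⟩, rfl⟩
  exact spaceTimePoint_ratioLimitKernel_mem hμ hfin hlazy hS y

/-- The map from the reduced ratio-limit compactification to the space-time Martin boundary which
sends `ξ` to the point with kernel values `Rᵐ H(x, ξ)`. -/
def reducedToBoundary (ξ : ReducedCompactification hμ hfin hlazy hS) : SpaceTimeBoundary μ :=
  ⟨spaceTimePoint μ ξ.1, spaceTimePoint_mem_boundary hμ hfin hlazy hS ξ⟩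

theorem continuous_reducedToBoundary : Continuous (reducedToBoundary hμ hfin hlazy hS) :=
  (continuous_spaceTimePoint.comp continuous_subtype_val).subtype_mk _

theorem reducedToBoundary_injective : Function.Injective (reducedToBoundary hμ hfin hlazy hS) :=
  fun _ _ h => Subtype.ext (spaceTimePoint_injective hμ hfin hlazy hS (congrArg Subtype.val h))

theorem compactSpace_reducedCompactification :
    CompactSpace (ReducedCompactification hμ hfin hlazy hS) := by
  rw [← isCompact_iff_compactSpace, ← fst_image_ratioLimitCompactification]
  exact (isCompact_ratioLimitCompactification hμ hfin hlazy hS).image continuous_fst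

theorem isEmbedding_reducedToBoundary :
    IsEmbedding (reducedToBoundary hμ hfin hlazy hS) := by
  have := compactSpace_reducedCompactification hμ hfin hlazy hS
  exact ((continuous_reducedToBoundary hμ hfin hlazy hS).isClosedEmbedding
    (reducedToBoundary_injective hμ hfin hlazy hS)).isEmbedding

end Maps

end SpaceTime

end

theorem theorem3p4 {Γ : Type*} [Group Γ] [Countable Γ] (μ : Γ → ℝ)
    (hμ : SpaceTime.IsAdmissible μ) (hfin : (Function.support μ).Finite) (hlazy : 0 < μ 1)
    (hsymm : ∀ x, μ x⁻¹ = μ x) (hS : SpaceTime.StrongRatioLimitProperty μ) :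
    CompactSpace (SpaceTime.RatioLimitCompactification μ) ∧
    CompactSpace (SpaceTime.ReducedCompactification hμ hfin hlazy hS) ∧
    CompactSpace (SpaceTime.SpaceTimeCompactification μ) ∧
    ∃ (Φ : SpaceTime.RatioLimitCompactification μ → SpaceTime.SpaceTimeBoundary μ)
      (Ψ : SpaceTime.RatioLimitCompactification μ →
        SpaceTime.ReducedCompactification hμ hfin hlazy hS)
      (Φr : SpaceTime.ReducedCompactification hμ hfin hlazy hS → SpaceTime.SpaceTimeBoundary μ),
      Continuous Φ ∧
      (Continuous Ψ ∧ Function.Surjective Ψ ∧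
        ∀ y : Γ, Ψ (SpaceTime.toCompactification (SpaceTime.ratioLimitKernel μ) y) =
          SpaceTime.toReducedCompactification hμ hfin hlazy hS (QuotientGroup.mk y)) ∧
      Topology.IsEmbedding Φr ∧
      Φ = Φr ∘ Ψ ∧
      ∀ (ξ : SpaceTime.ReducedCompactification hμ hfin hlazy hS) (p : SpaceTime.SpaceTimeSet μ),
        SpaceTime.boundaryKernel (SpaceTime.spaceTimeMartinKernel μ) p (Φr ξ) =
          SpaceTime.convergenceRadius μ ^ p.1.2 *
            SpaceTime.reducedKernel hμ hfin hlazy hS p.1.1 ξ := by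
  have hRL := SpaceTime.isCompact_ratioLimitCompactification hμ hfin hlazy hS
  have hST := SpaceTime.isCompact_spaceTimeCompactification hμ hfin
  have hΨ := SpaceTime.continuous_reduction hμ hfin hlazy hS
  have hΦ := SpaceTime.continuous_reducedToBoundary hμ hfin hlazy hS
  exact ⟨isCompact_iff_compactSpace.1 hRL,
    SpaceTime.compactSpace_reducedCompactification hμ hfin hlazy hS,
    isCompact_iff_compactSpace.1 hST, _, SpaceTime.reduction hμ hfin hlazy hS,
    SpaceTime.reducedToBoundary hμ hfin hlazy hS, hΦ.comp hΨ,
    ⟨hΨ, SpaceTime.reduction_surjective hμ hfin hlazy hS, fun _ => rfl⟩,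
    SpaceTime.isEmbedding_reducedToBoundary hμ hfin hlazy hS, rfl, fun _ _ => rfl⟩
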